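/- All graphs are finite and simple. For graphs $H$ and $G$, let $\hom(H,G)$ denote the number of graph homomorphisms from $H$ to $G$, i.e. of maps $V(H)\to V(G)$ sending adjacent vertices to adjacent vertices. Let $P_n$ denote the path on $n$ vertices; a leaf of a tree is a vertex of degree $1$. Let $T_m$ and $T_n$ be trees on $m$ and $n$ vertices, respectively. If $T_n$ has at least four leaves, then $$\hom(T_m,T_n)\geq (n-2)2^{m-1}+2 .$$ Consequently, for every tree $T_m$ on $m$ vertices and every tree $T_n$ on $n$ vertices with at least four leaves, $$\hom(T_m,T_n)\geq \hom(T_m,P_n).$$ -/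

import Mathlib

/-- The number of graph homomorphisms from `H` to `G`. -/
noncomputable def homCount {V W : Type*} (H : SimpleGraph V) (G : SimpleGraph W) : ℕ :=
  Nat.card (H →g G)

/-- The set of leaves of a finite graph, i.e. its vertices of degree one. -/
def leaves {V : Type*} [Fintype V] (G : SimpleGraph V) [DecidableRel G.Adj] : Finset V :=
  Finset.univ.filter fun v => G.degree v = 1

universe u v

open Finset

/-! Both counts are compared with `(n - 2) * 2 ^ (m - 1) + 2`. For the path, deleting a leaf of the
source gives `h(m) ≤ 2 * h(m - 1) - 2`: an image has at most two neighbours, and each end of the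
path, having only one, is hit at least once. For a tree with `L ≥ 4` leaves, the lower bound is an
entropy argument. Symmetric edge weights `w` with row sums `2 * ω` define a Markov chain with
transition probabilities `w x y / (2 * ω x)` and stationary measure `ω`. Running it along the source
tree weights the homomorphisms, with marginals and entropy independent of the shape of that tree
(`exists_weighting`). Since `y - y * log y ≤ 1`, the count is at least mass plus entropy
(`le_homCount_of_weights`). Weight `a` on leaf edges and `1` elsewhere suffices: `a = 1` for `m = 2,
3` and `a = 1/2` for `m ≥ 4`. -/

noncomputable instance homFintype {V : Type u} {W : Type v} [Finite V] [Finite W]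
    (H : SimpleGraph V) (G : SimpleGraph W) : Fintype (H →g G) :=
  haveI : Finite (H →g G) := DFunLike.finite _
  Fintype.ofFinite _

theorem homCount_eq_card {V : Type u} {W : Type v} [Finite V] [Finite W]
    (H : SimpleGraph V) (G : SimpleGraph W) : homCount H G = Fintype.card (H →g G) :=
  Nat.card_eq_fintype_card

/-! ### Deleting a leaf of the source tree -/

/-- Induction on finite trees by deleting a leaf `l` with neighbour `r`. -/
theorem SimpleGraph.IsTree.leaf_induction {P : ∀ (V : Type u) [Finite V], SimpleGraph V → Prop}
    (single : ∀ (V : Type u) [Unique V] (T : SimpleGraph V), P V T)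
    (step : ∀ (V : Type u) [Finite V] (T : SimpleGraph V) (r l : V), r ≠ l →
      T.Adj l r → (∀ x, T.Adj l x → x = r) → (T.induce {l}ᶜ).IsTree →
      P _ (T.induce {l}ᶜ) → P V T)
    {V : Type u} [Finite V] {T : SimpleGraph V} (hT : T.IsTree) : P V T := by
  classical
  induction h : Nat.card V using Nat.strong_induction_on generalizing V with
  | _ k ih =>
    have : Fintype V := Fintype.ofFinite V
    have : Nonempty V := hT.connected.nonempty
    rcases subsingleton_or_nontrivial V with hV | hV
    · have : Unique V := ⟨⟨hT.connected.nonempty.some⟩, fun a => Subsingleton.elim a _⟩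
      exact single V T
    · obtain ⟨l, hl⟩ := hT.exists_vert_degree_one_of_nontrivial
      obtain ⟨r, hr, huniq⟩ := SimpleGraph.degree_eq_one_iff_existsUnique_adj.mp hl
      have htree : (T.induce {l}ᶜ).IsTree :=
        ⟨hT.connected.induce_compl_singleton_of_degree_eq_one hl, hT.isAcyclic.induce _⟩
      refine step V T r l hr.ne' hr huniq htree (ih _ ?_ htree rfl)
      rw [← h]
      exact Finite.card_subtype_lt (x := l) (by simp)

/-- Homomorphisms from a graph with a leaf `l` at `r` are homomorphisms from the graph without `l`
together with a neighbour of the image of `r`. -/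
def leafHomEquiv {V : Type u} {W : Type v} [DecidableEq V] (T : SimpleGraph V) (G : SimpleGraph W)
    (r l : V) (hrl : r ≠ l) (hadj : T.Adj l r) (huniq : ∀ x, T.Adj l x → x = r) :
    (T →g G) ≃ Σ φ : (T.induce {l}ᶜ →g G), {x : W // G.Adj (φ ⟨r, hrl⟩) x} where
  toFun φ := ⟨⟨fun x => φ x, fun h => φ.map_adj h⟩, ⟨φ l, φ.map_adj hadj.symm⟩⟩
  invFun p := ⟨fun x => if h : x = l then p.2 else p.1 ⟨x, h⟩, by
    intro a b hab
    by_cases ha : a = l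
    · subst ha
      obtain rfl := huniq b hab
      simpa [hrl] using p.2.2.symm
    · by_cases hb : b = l
      · subst hb
        obtain rfl := huniq a hab.symm
        simpa [hrl] using p.2.2
      · simp only [ha, hb, dif_neg, not_false_eq_true]
        exact p.1.map_adj (by simpa using hab)⟩
  left_inv φ := by
    ext x
    by_cases h : x = l
    · subst h; simp
    · simp [h]
  right_inv p := by
    obtain ⟨φ, x, hx⟩ := p
    have h : (⟨fun y => if h : (y : V) = l then x else φ ⟨y, h⟩, by
        intro a b hab
        have ha : (a : V) ≠ l := a.2
        have hb : (b : V) ≠ l := b.2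
        simpa [ha, hb] using φ.map_adj hab⟩ : T.induce {l}ᶜ →g G) = φ := by
      ext y
      have hy : (y : V) ≠ l := y.2
      simp [hy]
    exact Sigma.subtype_ext h (by simp)

theorem leafHomEquiv_symm_leaf {V : Type u} {W : Type v} [DecidableEq V] (T : SimpleGraph V)
    (G : SimpleGraph W) (r l : V) (hrl : r ≠ l) (hadj : T.Adj l r)
    (huniq : ∀ x, T.Adj l x → x = r) (φ : T.induce {l}ᶜ →g G)
    (x : {x : W // G.Adj (φ ⟨r, hrl⟩) x}) :
    (leafHomEquiv T G r l hrl hadj huniq).symm ⟨φ, x⟩ l = x := by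
  change (if h : l = l then (x : W) else _) = x
  simp

theorem leafHomEquiv_symm_of_ne {V : Type u} {W : Type v} [DecidableEq V] (T : SimpleGraph V)
    (G : SimpleGraph W) (r l : V) (hrl : r ≠ l) (hadj : T.Adj l r)
    (huniq : ∀ x, T.Adj l x → x = r) (φ : T.induce {l}ᶜ →g G)
    (x : {x : W // G.Adj (φ ⟨r, hrl⟩) x}) (z : V) (hz : z ≠ l) :
    (leafHomEquiv T G r l hrl hadj huniq).symm ⟨φ, x⟩ z = φ ⟨z, hz⟩ := by
  change (if h : z = l then (x : W) else φ ⟨z, h⟩) = _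
  simp [hz]

open Classical in
theorem sum_hom_leaf {V : Type u} {W : Type v} [Finite V] [Fintype W] (T : SimpleGraph V)
    (G : SimpleGraph W) (r l : V) (hrl : r ≠ l) (hadj : T.Adj l r)
    (huniq : ∀ x, T.Adj l x → x = r) {M : Type*} [AddCommMonoid M] (f : (T →g G) → M) :
    ∑ φ, f φ = ∑ φ : (T.induce {l}ᶜ →g G), ∑ x : {x : W // G.Adj (φ ⟨r, hrl⟩) x},
      f ((leafHomEquiv T G r l hrl hadj huniq).symm ⟨φ, x⟩) := by
  rw [← Equiv.sum_comp (leafHomEquiv T G r l hrl hadj huniq).symm, Fintype.sum_sigma]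

theorem card_compl_singleton_add_one {V : Type u} [Finite V] (l : V) :
    Nat.card ({l}ᶜ : Set V) + 1 = Nat.card V := by
  have h := Set.ncard_add_ncard_compl ({l} : Set V)
  rw [Set.ncard_singleton] at h
  rw [Nat.card_coe_set_eq]
  omega

/-- In a graph without isolated vertices, every vertex is the image of every vertex of a tree. -/
theorem SimpleGraph.IsTree.exists_hom_apply_eq {V : Type u} {W : Type v} [Finite V]
    {T : SimpleGraph V} (hT : T.IsTree) (G : SimpleGraph W) (hG : ∀ a, ∃ b, G.Adj a b) :
    ∀ (z : V) (a : W), ∃ φ : T →g G, φ z = a := by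
  classical
  refine SimpleGraph.IsTree.leaf_induction
    (P := fun V _ T => ∀ (z : V) (a : W), ∃ φ : T →g G, φ z = a) ?_ ?_ hT
  · intro V _ T z a
    exact ⟨⟨fun _ => a, fun {x y} h => (h.ne (Subsingleton.elim x y)).elim⟩, rfl⟩
  · intro V _ T r l hrl hadj huniq htree ih z a
    by_cases hz : z = l
    · subst hz
      obtain ⟨b, hb⟩ := hG a
      obtain ⟨φ, hφ⟩ := ih ⟨r, hrl⟩ b
      exact ⟨(leafHomEquiv T G r z hrl hadj huniq).symm ⟨φ, ⟨a, by rw [hφ]; exact hb.symm⟩⟩,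
        leafHomEquiv_symm_leaf ..⟩
    · obtain ⟨φ, hφ⟩ := ih ⟨z, hz⟩ a
      obtain ⟨b, hb⟩ := hG (φ ⟨r, hrl⟩)
      exact ⟨(leafHomEquiv T G r l hrl hadj huniq).symm ⟨φ, ⟨b, hb⟩⟩,
        (leafHomEquiv_symm_of_ne _ _ _ _ _ _ _ _ _ z hz).trans hφ⟩

/-! ### Upper bound for paths -/

open Classical in
theorem card_pathGraph_adj_le {k : ℕ} (a : Fin (k + 2)) :
    Fintype.card {x // (SimpleGraph.pathGraph (k + 2)).Adj a x} +
      ((if a = 0 then 1 else 0) + if a = Fin.last (k + 1) then 1 else 0) ≤ 2 := by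
  have hsub : (a = 0 ∨ a = Fin.last (k + 1)) →
      Fintype.card {x // (SimpleGraph.pathGraph (k + 2)).Adj a x} ≤ 1 := by
    intro h
    refine Fintype.card_le_one_iff_subsingleton.mpr ⟨fun x y => Subtype.ext (Fin.ext ?_)⟩
    have hx := SimpleGraph.pathGraph_adj.mp x.2
    have hy := SimpleGraph.pathGraph_adj.mp y.2
    have := x.1.2
    have := y.1.2
    rcases h with rfl | rfl
    · simp only [Fin.val_zero] at hx hy
      omega
    · simp only [Fin.val_last] at hx hy
      omega
  have htwo : Fintype.card {x // (SimpleGraph.pathGraph (k + 2)).Adj a x} ≤ 2 := by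
    -- A neighbour is determined by the side of `a` on which it lies.
    refine (Fintype.card_le_of_injective (β := Bool) (fun x => decide (a < x.1)) ?_).trans_eq
      Fintype.card_bool
    intro x y hxy
    refine Subtype.ext (Fin.ext ?_)
    have hx := SimpleGraph.pathGraph_adj.mp x.2
    have hy := SimpleGraph.pathGraph_adj.mp y.2
    simp only [decide_eq_decide, Fin.lt_def] at hxy
    omega
  by_cases h0 : a = 0
  · have h1 : a ≠ Fin.last (k + 1) := by
      rw [h0]
      exact (Fin.last_pos).ne
    have := hsub (Or.inl h0)
    simp only [h0, if_true] at h1 this ⊢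
    simp only [h1, if_false]
    omega
  · by_cases h1 : a = Fin.last (k + 1)
    · have := hsub (Or.inr h1)
      simp only [h1, if_true] at this ⊢
      split_ifs <;> omega
    · simpa [h0, h1] using htwo

/-- The number of homomorphisms from a tree to a path is at most that from a star. -/
theorem SimpleGraph.IsTree.homCount_pathGraph_le {V : Type u} [Finite V] {T : SimpleGraph V}
    (hT : T.IsTree) (k : ℕ) :
    homCount T (SimpleGraph.pathGraph (k + 2)) ≤ k * 2 ^ (Nat.card V - 1) + 2 := by
  classical
  refine SimpleGraph.IsTree.leaf_induction
    (P := fun V _ T => homCount T (SimpleGraph.pathGraph (k + 2)) ≤ k * 2 ^ (Nat.card V - 1) + 2) ?_ ?_ hT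
  · intro V _ T
    rw [homCount_eq_card]
    refine (Fintype.card_le_of_injective (β := V → Fin (k + 2)) _ DFunLike.coe_injective).trans ?_
    simp
  · intro V _ T r l hrl hadj huniq htree ih
    have hcard := card_compl_singleton_add_one l
    have hne : Nat.card ({l}ᶜ : Set V) ≠ 0 := by
      have : Nonempty ({l}ᶜ : Set V) := ⟨⟨r, hrl⟩⟩
      exact Nat.card_pos.ne'
    obtain ⟨j, hj⟩ := Nat.exists_eq_succ_of_ne_zero hne
    rw [← hcard]
    rw [hj] at ih ⊢
    rw [homCount_eq_card] at ih ⊢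
    have hG : ∀ a : Fin (k + 2), ∃ b, (SimpleGraph.pathGraph (k + 2)).Adj a b := by
      intro a
      by_cases h : a.val + 1 < k + 2
      · exact ⟨⟨a + 1, h⟩, SimpleGraph.pathGraph_adj.mpr (Or.inl rfl)⟩
      · refine ⟨⟨a - 1, by omega⟩, SimpleGraph.pathGraph_adj.mpr (Or.inr ?_)⟩
        have := a.2
        simp only
        omega
    -- Applied to the two ends, this yields the `-2` in the recursion.
    have hend : ∀ a : Fin (k + 2), 1 ≤ ∑ φ : (T.induce {l}ᶜ →g SimpleGraph.pathGraph (k + 2)),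
        if φ ⟨r, hrl⟩ = a then 1 else 0 := by
      intro a
      obtain ⟨φ, hφ⟩ := htree.exists_hom_apply_eq _ hG ⟨r, hrl⟩ a
      rw [Finset.sum_boole, Nat.cast_id, Nat.one_le_iff_ne_zero, ← Nat.pos_iff_ne_zero,
        Finset.card_pos]
      exact ⟨φ, by simp [hφ]⟩
    have hcount : Fintype.card (T →g SimpleGraph.pathGraph (k + 2)) =
        ∑ φ : (T.induce {l}ᶜ →g SimpleGraph.pathGraph (k + 2)),
          Fintype.card {x // (SimpleGraph.pathGraph (k + 2)).Adj (φ ⟨r, hrl⟩) x} := by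
      rw [Fintype.card_eq_sum_ones, sum_hom_leaf T _ r l hrl hadj huniq]
      simp
    have hsum := Finset.sum_le_sum fun (φ : T.induce {l}ᶜ →g SimpleGraph.pathGraph (k + 2))
      (_ : φ ∈ Finset.univ) => card_pathGraph_adj_le (φ ⟨r, hrl⟩)
    rw [Finset.sum_add_distrib, Finset.sum_add_distrib, ← hcount, Finset.sum_const,
      Finset.card_univ, smul_eq_mul] at hsum
    have h0 := hend 0
    have h1 := hend (Fin.last (k + 1))
    simp only [Nat.succ_eq_add_one, Nat.add_sub_cancel, pow_succ] at ih ⊢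
    nlinarith

/-! ### Markov chains and entropy -/

open Classical in
theorem sum_adj_subtype {W : Type v} [Fintype W] (G : SimpleGraph W) (a : W) (f : W → ℝ)
    (hf : ∀ x, ¬ G.Adj a x → f x = 0) :
    ∑ x : {x // G.Adj a x}, f x = ∑ x, f x := by
  rw [← Finset.sum_subtype (Finset.univ.filter (G.Adj a)) (by simp) f]
  refine Finset.sum_subset (Finset.subset_univ _) fun x _ hx => hf x ?_
  simpa using hx

/-- A Markov chain on `G` with edge weights `w` gives a positive weighting of the homomorphisms
from a tree to `G` with prescribed marginals and entropy. -/
theorem SimpleGraph.IsTree.exists_weighting {V : Type u} {W : Type v} [Finite V] [Fintype W]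
    {T : SimpleGraph V} (hT : T.IsTree) (G : SimpleGraph W) (w : W → W → ℝ) (ω : W → ℝ)
    (hsymm : ∀ x y, w x y = w y x) (hpos : ∀ x y, G.Adj x y → 0 < w x y)
    (hzero : ∀ x y, ¬ G.Adj x y → w x y = 0) (hω : ∀ x, ∑ y, w x y = 2 * ω x)
    (hωpos : ∀ x, 0 < ω x) :
    ∃ y : (T →g G) → ℝ, (∀ φ, 0 < y φ) ∧
      (∀ (z : V) (F : W → ℝ),
        ∑ φ, y φ * F (φ z) = 2 ^ (Nat.card V - 1) * ∑ x, ω x * F x) ∧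
      ∑ φ, y φ * Real.log (y φ) = 2 ^ (Nat.card V - 1) * (∑ x, ω x * Real.log (ω x) +
        ((Nat.card V - 1 : ℕ) : ℝ) * ((∑ x, ∑ y, w x y * Real.log (w x y / ω x)) / 2)) := by
  classical
  refine SimpleGraph.IsTree.leaf_induction
    (P := fun V _ T => ∃ y : (T →g G) → ℝ, (∀ φ, 0 < y φ) ∧
      (∀ (z : V) (F : W → ℝ),
        ∑ φ, y φ * F (φ z) = 2 ^ (Nat.card V - 1) * ∑ x, ω x * F x) ∧
      ∑ φ, y φ * Real.log (y φ) = 2 ^ (Nat.card V - 1) * (∑ x, ω x * Real.log (ω x) +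
        ((Nat.card V - 1 : ℕ) : ℝ) * ((∑ x, ∑ y, w x y * Real.log (w x y / ω x)) / 2))) ?_ ?_ hT
  · intro V _ T
    let e : (T →g G) ≃ W :=
      { toFun := fun φ => φ default
        invFun := fun a => ⟨fun _ => a, fun {x y} h => (h.ne (Subsingleton.elim x y)).elim⟩
        left_inv := fun φ => by
          ext x
          exact congrArg φ (Subsingleton.elim _ _)
        right_inv := fun a => rfl }
    refine ⟨fun φ => ω (φ default), fun φ => hωpos _, fun z F => ?_, ?_⟩
    · obtain rfl := Subsingleton.elim default z
      simp only [Nat.card_unique, Nat.sub_self, pow_zero, one_mul]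
      exact Equiv.sum_comp e (fun a => ω a * F a)
    · simp only [Nat.card_unique, Nat.sub_self, pow_zero, one_mul, Nat.cast_zero,
        zero_mul, add_zero]
      exact Equiv.sum_comp e (fun a => ω a * Real.log (ω a))
  · intro V _ T r l hrl hadj huniq htree ih
    obtain ⟨y, hy, hmarg, hent⟩ := ih
    have hcard := card_compl_singleton_add_one l
    have hne : Nat.card ({l}ᶜ : Set V) ≠ 0 := by
      have : Nonempty ({l}ᶜ : Set V) := ⟨⟨r, hrl⟩⟩
      exact Nat.card_pos.ne'
    obtain ⟨j, hj⟩ := Nat.exists_eq_succ_of_ne_zero hne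
    rw [← hcard]
    rw [hj] at hmarg hent ⊢
    simp only [Nat.succ_eq_add_one, Nat.add_sub_cancel, pow_succ] at hmarg hent ⊢
    let e := leafHomEquiv T G r l hrl hadj huniq
    have hsum : ∀ f : (Σ φ : (T.induce {l}ᶜ →g G), {x : W // G.Adj (φ ⟨r, hrl⟩) x}) → ℝ,
        ∑ φ, f (e φ) = ∑ φ, ∑ x, f ⟨φ, x⟩ := fun f => by
      rw [Equiv.sum_comp e f, Fintype.sum_sigma]
    -- One more chain step from `r`. The factors `w / ω` sum to `2`, so each new vertex doubles the
    -- mass.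
    refine ⟨fun φ => y (e φ).1 * (w ((e φ).1 ⟨r, hrl⟩) (e φ).2 / ω ((e φ).1 ⟨r, hrl⟩)),
      fun φ => mul_pos (hy _) (div_pos (hpos _ _ (e φ).2.2) (hωpos _)), fun z F => ?_, ?_⟩
    · by_cases hz : z = l
      · subst hz
        have h1 := hsum fun p => y p.1 * (w (p.1 ⟨r, hrl⟩) p.2 / ω (p.1 ⟨r, hrl⟩)) * F p.2
        refine h1.trans ?_
        have h2 : ∀ φ : (T.induce {z}ᶜ →g G), ∑ x : {x : W // G.Adj (φ ⟨r, hrl⟩) x},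
            y φ * (w (φ ⟨r, hrl⟩) x / ω (φ ⟨r, hrl⟩)) * F x =
            y φ * ∑ x, w (φ ⟨r, hrl⟩) x / ω (φ ⟨r, hrl⟩) * F x := by
          intro φ
          rw [← sum_adj_subtype G (φ ⟨r, hrl⟩) (fun x => w (φ ⟨r, hrl⟩) x / ω (φ ⟨r, hrl⟩) * F x)
            (fun x hx => by simp [hzero _ _ hx]), Finset.mul_sum]
          exact Finset.sum_congr rfl fun x _ => mul_assoc _ _ _
        simp only [h2]
        -- By symmetry of `w`, `ω` is stationary, so the new leaf has the same marginal as `r`.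
        rw [hmarg ⟨r, hrl⟩ fun a => ∑ x, w a x / ω a * F x, mul_assoc]
        congr 1
        simp only [Finset.mul_sum]
        rw [Finset.sum_comm]
        refine Finset.sum_congr rfl fun x _ => ?_
        rw [← mul_assoc, ← hω, Finset.sum_mul]
        refine Finset.sum_congr rfl fun a _ => ?_
        rw [hsymm x a, ← mul_assoc, mul_div_cancel₀ _ (hωpos a).ne']
      · have h1 := hsum fun p => y p.1 * (w (p.1 ⟨r, hrl⟩) p.2 / ω (p.1 ⟨r, hrl⟩)) *
          F (p.1 ⟨z, hz⟩)
        refine h1.trans ?_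
        have h2 : ∀ φ : (T.induce {l}ᶜ →g G), ∑ x : {x : W // G.Adj (φ ⟨r, hrl⟩) x},
            y φ * (w (φ ⟨r, hrl⟩) x / ω (φ ⟨r, hrl⟩)) * F (φ ⟨z, hz⟩) =
            y φ * F (φ ⟨z, hz⟩) * 2 := by
          intro φ
          rw [← Finset.sum_mul, ← Finset.mul_sum, ← Finset.sum_div,
            sum_adj_subtype G (φ ⟨r, hrl⟩) (fun x => w (φ ⟨r, hrl⟩) x)
              (fun x hx => hzero _ _ hx), hω, mul_div_cancel_right₀ _ (hωpos _).ne']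
          ring
        simp only [h2]
        rw [← Finset.sum_mul, hmarg ⟨z, hz⟩ F]
        ring
    · have h1 := hsum fun p => y p.1 * (w (p.1 ⟨r, hrl⟩) p.2 / ω (p.1 ⟨r, hrl⟩)) *
        Real.log (y p.1 * (w (p.1 ⟨r, hrl⟩) p.2 / ω (p.1 ⟨r, hrl⟩)))
      refine h1.trans ?_
      -- Chain rule: the logarithm splits, and the new term depends on `φ` only through `φ r`.
      have h2 : ∀ φ : (T.induce {l}ᶜ →g G), ∑ x : {x : W // G.Adj (φ ⟨r, hrl⟩) x},
          y φ * (w (φ ⟨r, hrl⟩) x / ω (φ ⟨r, hrl⟩)) *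
            Real.log (y φ * (w (φ ⟨r, hrl⟩) x / ω (φ ⟨r, hrl⟩))) =
          y φ * Real.log (y φ) * 2 + y φ * ∑ x, w (φ ⟨r, hrl⟩) x / ω (φ ⟨r, hrl⟩) *
            Real.log (w (φ ⟨r, hrl⟩) x / ω (φ ⟨r, hrl⟩)) := by
        intro φ
        have h3 : y φ * Real.log (y φ) * 2 = y φ * Real.log (y φ) *
            ∑ x, w (φ ⟨r, hrl⟩) x / ω (φ ⟨r, hrl⟩) := by
          rw [← Finset.sum_div, hω, mul_div_cancel_right₀ _ (hωpos _).ne']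
        rw [h3, ← sum_adj_subtype G (φ ⟨r, hrl⟩) (fun x => w (φ ⟨r, hrl⟩) x / ω (φ ⟨r, hrl⟩))
            (fun x hx => by simp [hzero _ _ hx]),
          ← sum_adj_subtype G (φ ⟨r, hrl⟩) (fun x => w (φ ⟨r, hrl⟩) x / ω (φ ⟨r, hrl⟩) *
            Real.log (w (φ ⟨r, hrl⟩) x / ω (φ ⟨r, hrl⟩)))
            (fun x hx => by simp [hzero _ _ hx]), Finset.mul_sum, Finset.mul_sum,
          ← Finset.sum_add_distrib]
        refine Finset.sum_congr rfl fun x _ => ?_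
        rw [Real.log_mul (hy φ).ne' (div_pos (hpos _ _ x.2) (hωpos _)).ne']
        ring
      simp only [h2]
      rw [Finset.sum_add_distrib, ← Finset.sum_mul, hent,
        hmarg ⟨r, hrl⟩ fun a => ∑ x, w a x / ω a * Real.log (w a x / ω a)]
      have h4 : ∀ a, ω a * ∑ x, w a x / ω a * Real.log (w a x / ω a) =
          ∑ x, w a x * Real.log (w a x / ω a) := by
        intro a
        rw [Finset.mul_sum]
        refine Finset.sum_congr rfl fun x _ => ?_
        rw [← mul_assoc, mul_div_cancel₀ _ (hωpos a).ne']
      simp only [h4]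
      push_cast
      ring

/-- Lower bound for the number of homomorphisms from a tree in terms of edge weights. -/
theorem SimpleGraph.IsTree.le_homCount_of_weights {V : Type u} {W : Type v} [Finite V] [Fintype W]
    {T : SimpleGraph V} (hT : T.IsTree) (G : SimpleGraph W) (w : W → W → ℝ) (ω : W → ℝ)
    (hsymm : ∀ x y, w x y = w y x) (hpos : ∀ x y, G.Adj x y → 0 < w x y)
    (hzero : ∀ x y, ¬ G.Adj x y → w x y = 0) (hω : ∀ x, ∑ y, w x y = 2 * ω x)
    (hωpos : ∀ x, 0 < ω x) :
    2 ^ (Nat.card V - 1) * (∑ x, ω x - ∑ x, ω x * Real.log (ω x) - ((Nat.card V - 1 : ℕ) : ℝ) *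
      ((∑ x, ∑ y, w x y * Real.log (w x y)) / 2 - ∑ x, ω x * Real.log (ω x))) ≤
      (homCount T G : ℝ) := by
  obtain ⟨y, hy, hmarg, hent⟩ := hT.exists_weighting G w ω hsymm hpos hzero hω hωpos
  obtain ⟨z⟩ := hT.connected.nonempty
  have h1 := hmarg z fun _ => 1
  simp only [mul_one] at h1
  -- Each summand is at most `1`, by `log y ≥ 1 - 1 / y`.
  have h2 : ∑ φ, (y φ - y φ * Real.log (y φ)) ≤ ∑ _φ : (T →g G), (1 : ℝ) := by
    refine Finset.sum_le_sum fun φ _ => ?_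
    have h := mul_le_mul_of_nonneg_left (Real.one_sub_inv_le_log_of_pos (hy φ)) (hy φ).le
    rw [mul_sub, mul_inv_cancel₀ (hy φ).ne'] at h
    linarith
  rw [Finset.sum_sub_distrib, h1, hent, Finset.sum_const, Finset.card_univ, nsmul_one,
    ← homCount_eq_card] at h2
  have h3 : ∑ x, ∑ y, w x y * Real.log (w x y / ω x) =
      ∑ x, ∑ y, w x y * Real.log (w x y) - 2 * ∑ x, ω x * Real.log (ω x) := by
    rw [Finset.mul_sum, ← Finset.sum_sub_distrib]
    refine Finset.sum_congr rfl fun x _ => ?_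
    rw [← mul_assoc, ← hω, Finset.sum_mul, ← Finset.sum_sub_distrib]
    refine Finset.sum_congr rfl fun a _ => ?_
    by_cases h : G.Adj x a
    · rw [Real.log_div (hpos _ _ h).ne' (hωpos x).ne']
      ring
    · simp [hzero _ _ h]
  rw [h3] at h2
  refine le_trans (le_of_eq ?_) h2
  ring

/-! ### Weights on leaf edges -/

/-- Two leaves of a connected graph with at least three vertices are not adjacent. -/
theorem SimpleGraph.Connected.not_adj_of_degree_eq_one {W : Type v} [Fintype W]
    {G : SimpleGraph W} [DecidableRel G.Adj] (hG : G.Connected) (hcard : 3 ≤ Fintype.card W)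
    {x y : W} (hx : G.degree x = 1) (hy : G.degree y = 1) : ¬ G.Adj x y := by
  classical
  intro hxy
  obtain ⟨x', hx', hxu⟩ := SimpleGraph.degree_eq_one_iff_existsUnique_adj.mp hx
  obtain ⟨y', hy', hyu⟩ := SimpleGraph.degree_eq_one_iff_existsUnique_adj.mp hy
  obtain rfl := hxu y hxy
  obtain rfl := hyu x hxy.symm
  have hall : ∀ z, z = x ∨ z = y := by
    intro z
    have h := (SimpleGraph.reachable_iff_reflTransGen x z).mp (hG.preconnected x z)
    induction h with
    | refl => exact Or.inl rfl
    | tail _ hbc ih =>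
      rcases ih with rfl | rfl
      · exact Or.inr (hxu _ hbc)
      · exact Or.inl (hyu _ hbc)
  have : Fintype.card W ≤ ({x, y} : Finset W).card :=
    Finset.card_le_card fun z _ => by simpa using hall z
  have := Finset.card_le_two (a := x) (b := y)
  omega

/-- The bound of `le_homCount_of_weights` for weight `a` on edges at leaves and `1` elsewhere. -/
theorem SimpleGraph.IsTree.le_homCount_of_leaf_weight {V : Type u} {W : Type v} [Finite V]
    [Fintype W] {T : SimpleGraph V} (hT : T.IsTree) {G : SimpleGraph W} [DecidableRel G.Adj]
    (hG : G.IsTree) (hcard : 3 ≤ Fintype.card W) {a : ℝ} (ha : 0 < a) (k : ℕ)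
    (hk : Nat.card V = k + 2) :
    2 ^ (k + 1) * ((Fintype.card W : ℝ) - 1 - (1 - a) * (leaves G).card +
      k * (-1 + a * (leaves G).card / 2 + (leaves G).card * (a / 2 * Real.log (a / 2))) -
      (k + 1) * ((leaves G).card * (a * Real.log a))) ≤ (homCount T G : ℝ) := by
  classical
  let A : W → W → ℝ := fun x y => if G.Adj x y then 1 else 0
  let lam : W → ℝ := fun x => if G.degree x = 1 then 1 else 0
  -- No edge joins two leaves, so the only edge weights are `a` and `1`.
  let w : W → W → ℝ := fun x y => A x y * (1 - (1 - a) * (lam x + lam y))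
  let ω : W → ℝ := fun x => (∑ y, w x y) / 2
  have : Nontrivial W := Fintype.one_lt_card_iff_nontrivial.mp (by omega)
  have hA : ∀ x y, A x y = A y x := fun x y => by simp [A, G.adj_comm]
  have hAdeg : ∀ x, ∑ y, A x y = G.degree x := fun x => by
    simp [A, ← SimpleGraph.card_neighborFinset_eq_degree, SimpleGraph.neighborFinset_eq_filter]
  have hlam : ∑ x, lam x = (leaves G).card := by
    simp [lam, leaves]
  have hlamdeg : ∀ x, lam x * G.degree x = lam x := fun x => by
    by_cases h : G.degree x = 1 <;> simp [lam, h]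
  have hlamsum : ∑ x, ∑ y, A x y * lam x = (leaves G).card := by
    rw [← hlam]
    refine Finset.sum_congr rfl fun x _ => ?_
    rw [← Finset.sum_mul, hAdeg, mul_comm, hlamdeg]
  have hlamsum' : ∑ x, ∑ y, A x y * lam y = (leaves G).card := by
    rw [Finset.sum_comm, ← hlamsum]
    exact Finset.sum_congr rfl fun x _ => Finset.sum_congr rfl fun y _ => by rw [hA]
  have hnadj : ∀ {x y}, G.degree x = 1 → G.degree y = 1 → ¬ G.Adj x y :=
    hG.connected.not_adj_of_degree_eq_one hcard
  have hval : ∀ x y, G.Adj x y → (w x y = a ∧ lam x + lam y = 1) ∨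
      (w x y = 1 ∧ lam x + lam y = 0) := by
    intro x y h
    by_cases hx : G.degree x = 1
    · have hy : G.degree y ≠ 1 := fun hy => hnadj hx hy h
      left
      simp [w, A, lam, h, hx, hy]
    · by_cases hy : G.degree y = 1
      · left
        simp [w, A, lam, h, hx, hy]
      · right
        simp [w, A, lam, h, hx, hy]
  have hpos : ∀ x y, G.Adj x y → 0 < w x y := by
    intro x y h
    rcases hval x y h with h | h <;> rw [h.1]
    · exact ha
    · exact one_pos
  have hzero : ∀ x y, ¬ G.Adj x y → w x y = 0 := fun x y h => by simp [w, A, h]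
  have hsymm : ∀ x y, w x y = w y x := fun x y => by
    simp only [w, hA x y, add_comm (lam x)]
  have hω : ∀ x, ∑ y, w x y = 2 * ω x := fun x => by simp only [ω]; ring
  have hωpos : ∀ x, 0 < ω x := by
    intro x
    obtain ⟨y, hy⟩ := hG.connected.preconnected.exists_adj_of_nontrivial x
    refine half_pos (Finset.sum_pos' (fun z _ => ?_) ⟨y, Finset.mem_univ _, hpos _ _ hy⟩)
    by_cases h : G.Adj x z
    · exact (hpos _ _ h).le
    · exact (hzero _ _ h).ge
  have hdegsum : ∑ x, (G.degree x : ℝ) = 2 * ((Fintype.card W : ℝ) - 1) := by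
    have h1 := G.sum_degrees_eq_twice_card_edges
    have h2 := hG.card_edgeFinset
    rw [← h2, ← Nat.cast_sum, h1]
    push_cast
    ring
  have hΩ : ∑ x, ω x = (Fintype.card W : ℝ) - 1 - (1 - a) * (leaves G).card := by
    have h : ∑ x, 2 * ω x = ∑ x, ∑ y, A x y - (1 - a) * (∑ x, ∑ y, A x y * lam x) -
        (1 - a) * (∑ x, ∑ y, A x y * lam y) := by
      simp only [← hω, w, Finset.mul_sum, ← Finset.sum_sub_distrib]
      exact Finset.sum_congr rfl fun x _ => Finset.sum_congr rfl fun y _ => by ring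
    rw [← Finset.mul_sum, hlamsum, hlamsum'] at h
    simp only [hAdeg] at h
    rw [hdegsum] at h
    linarith
  have hwlog : ∑ x, ∑ y, w x y * Real.log (w x y) = 2 * ((leaves G).card * (a * Real.log a)) := by
    have h : ∑ x, ∑ y, w x y * Real.log (w x y) =
        (∑ x, ∑ y, A x y * lam x + ∑ x, ∑ y, A x y * lam y) * (a * Real.log a) := by
      rw [← Finset.sum_add_distrib, Finset.sum_mul]
      refine Finset.sum_congr rfl fun x _ => ?_
      rw [← Finset.sum_add_distrib, Finset.sum_mul]
      refine Finset.sum_congr rfl fun y _ => ?_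
      rw [← mul_add]
      by_cases hxy : G.Adj x y
      · rcases hval x y hxy with h | h <;> rw [h.1, h.2] <;> simp [A, hxy]
      · rw [hzero x y hxy]
        simp [A, hxy]
    rw [h, hlamsum, hlamsum']
    ring
  have hωleaf : ∀ x, G.degree x = 1 → ω x = a / 2 := by
    intro x hx
    have h : ∑ y, w x y = ∑ y, A x y * a := by
      refine Finset.sum_congr rfl fun y _ => ?_
      by_cases hxy : G.Adj x y
      · have hy : G.degree y ≠ 1 := fun hy => hnadj hx hy hxy
        simp [w, A, lam, hxy, hx, hy]
      · simp [w, A, hxy]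
    simp only [ω]
    rw [h, ← Finset.sum_mul, hAdeg, hx]
    simp
  -- Exact at leaves, where `ω = a / 2`; elsewhere `t * log t ≥ t - 1` is used.
  have hent : -1 + a * (leaves G).card / 2 + (leaves G).card * (a / 2 * Real.log (a / 2)) ≤
      ∑ x, ω x * Real.log (ω x) := by
    have h : ∑ x, (ω x - 1 + lam x * (a / 2 * Real.log (a / 2) - a / 2 + 1)) ≤
        ∑ x, ω x * Real.log (ω x) := by
      refine Finset.sum_le_sum fun x _ => ?_
      by_cases hx : G.degree x = 1
      · rw [hωleaf x hx]
        simp [lam, hx]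
      · have h := mul_le_mul_of_nonneg_left (Real.one_sub_inv_le_log_of_pos (hωpos x))
          (hωpos x).le
        rw [mul_sub, mul_inv_cancel₀ (hωpos x).ne'] at h
        simpa [lam, hx] using h
    rw [Finset.sum_add_distrib, Finset.sum_sub_distrib, hΩ, ← Finset.sum_mul, hlam] at h
    simp only [Finset.sum_const, Finset.card_univ, nsmul_one] at h
    linarith
  have hmain := hT.le_homCount_of_weights G w ω hsymm hpos hzero hω hωpos
  rw [hk, hΩ, hwlog] at hmain
  refine le_trans (mul_le_mul_of_nonneg_left ?_ (by positivity)) hmain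
  -- The net coefficient of `∑ ω * log ω` is `(k + 1) - 1 = k ≥ 0`, so a lower bound on that sum
  -- suffices.
  have := mul_le_mul_of_nonneg_left hent (Nat.cast_nonneg (α := ℝ) k)
  simp only [Nat.add_succ_sub_one]
  push_cast
  linarith

/-! ### Choice of the leaf weight and conclusion -/

/-- If `G` is a tree with at least four leaves, then `hom(T, G) ≥ (|G| - 2) 2 ^ (|T| - 1) + 2`
for every tree `T`. -/
theorem SimpleGraph.IsTree.le_homCount {V : Type u} {W : Type v} [Finite V] [Fintype W]
    {T : SimpleGraph V} (hT : T.IsTree) {G : SimpleGraph W} [DecidableRel G.Adj]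
    (hG : G.IsTree) (hleaves : 4 ≤ (leaves G).card) :
    ((Fintype.card W : ℝ) - 2) * 2 ^ (Nat.card V - 1) + 2 ≤ (homCount T G : ℝ) := by
  have hcard : 4 ≤ Fintype.card W := hleaves.trans (Finset.card_le_univ _)
  have hL : (4 : ℝ) ≤ (leaves G).card := by exact_mod_cast hleaves
  have hlog1 := Real.log_two_gt_d9
  have hlog2 := Real.log_two_lt_d9
  have hloghalf : Real.log (1 / 2) = -Real.log 2 := by rw [one_div, Real.log_inv]
  have hV : Nat.card V ≠ 0 := by
    have := hT.connected.nonempty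
    exact Nat.card_pos.ne'
  obtain ⟨j, hj⟩ := Nat.exists_eq_succ_of_ne_zero hV
  rcases j with _ | k
  · have : Subsingleton V := (Nat.card_eq_one_iff_unique.mp hj).1
    obtain ⟨z⟩ := hT.connected.nonempty
    have h : Fintype.card W ≤ homCount T G := by
      rw [homCount_eq_card]
      refine Fintype.card_le_of_injective
        (fun a => (⟨fun _ => a, fun {x y} h => (h.ne (Subsingleton.elim x y)).elim⟩ : T →g G))
        fun a b hab => ?_
      exact congrArg (fun φ : T →g G => φ z) hab
    rw [hj]
    have : (Fintype.card W : ℝ) ≤ homCount T G := by exact_mod_cast h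
    simpa using this
  · rw [hj]
    simp only [Nat.succ_eq_add_one, Nat.add_sub_cancel]
    -- With `a = 1`, the case `k = 0` is an equality, and for `k = 1` the surplus `2 * L * (1 - log
    -- 2)` exceeds `2`.
    rcases lt_or_ge k 2 with hk | hk
    · have h := hT.le_homCount_of_leaf_weight hG (by omega) one_pos k hj
      rw [hloghalf, Real.log_one] at h
      interval_cases k
      · norm_num at h ⊢
        linarith
      · norm_num at h ⊢
        nlinarith
    · have h := hT.le_homCount_of_leaf_weight hG (by omega) (a := 1 / 2) (by norm_num) k hj
      have hlogq : Real.log (1 / 2 / 2) = -(2 * Real.log 2) := by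
        rw [show (1 / 2 / 2 : ℝ) = (2 ^ 2)⁻¹ by norm_num, Real.log_inv, Real.log_pow]
        norm_num
      rw [hloghalf, hlogq] at h
      refine le_trans ?_ h
      have hpow : (8 : ℝ) ≤ 2 ^ (k + 1) := by
        calc (8 : ℝ) = 2 ^ 3 := by norm_num
          _ ≤ 2 ^ (k + 1) := pow_le_pow_right₀ (by norm_num) (by omega)
      have hk' : (2 : ℝ) ≤ k := by exact_mod_cast hk
      -- The surplus `1 / 4`, times `2 ^ (k + 1) ≥ 8`, pays for the `+ 2`.
      have h1 : (Fintype.card W : ℝ) - 2 + 1 / 4 ≤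
          (Fintype.card W : ℝ) - 1 - (1 - 1 / 2) * (leaves G).card +
          k * (-1 + 1 / 2 * (leaves G).card / 2 +
            (leaves G).card * (1 / 2 / 2 * -(2 * Real.log 2))) -
          (k + 1) * ((leaves G).card * (1 / 2 * -Real.log 2)) := by
        -- For `a = 1/2` the terms in `k * log 2` cancel and `k` has coefficient `(L - 4) / 4`,
        -- hence four leaves. What remains is `2 * log 2 > 5 / 4`.
        have h2 : 0 ≤ ((k : ℝ) - 2) * ((leaves G).card - 4) :=
          mul_nonneg (by linarith) (by linarith)
        have h3 : 0 ≤ ((leaves G).card - 4 : ℝ) * Real.log 2 :=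
          mul_nonneg (by linarith) (by linarith)
        linarith
      have h2 := mul_le_mul_of_nonneg_left h1 (by positivity : (0 : ℝ) ≤ 2 ^ (k + 1))
      linarith

theorem mainTheorem5 {V W : Type*} [Fintype V] [Fintype W]
    (Tm : SimpleGraph V) (Tn : SimpleGraph W) [DecidableRel Tn.Adj]
    (m n : ℕ) (hm : Fintype.card V = m) (hn : Fintype.card W = n)
    (hTm : Tm.IsTree) (hTn : Tn.IsTree) (hleaves : 4 ≤ (leaves Tn).card) :
    ((n : ℤ) - 2) * 2 ^ (m - 1) + 2 ≤ (homCount Tm Tn : ℤ) ∧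
      homCount Tm (SimpleGraph.pathGraph n) ≤ homCount Tm Tn := by
  have h := hTm.le_homCount hTn hleaves
  rw [Nat.card_eq_fintype_card, hm, hn] at h
  have h1 : ((n : ℤ) - 2) * 2 ^ (m - 1) + 2 ≤ (homCount Tm Tn : ℤ) := by exact_mod_cast h
  refine ⟨h1, ?_⟩
  have hcard : 4 ≤ n := hn ▸ hleaves.trans (Finset.card_le_univ _)
  obtain ⟨k, rfl⟩ := Nat.exists_eq_add_of_le' (show 2 ≤ n by omega)
  have h2 := hTm.homCount_pathGraph_le k
  rw [Nat.card_eq_fintype_card, hm] at h2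
  push_cast at h1
  rw [add_sub_cancel_right] at h1
  exact_mod_cast (le_trans (by exact_mod_cast h2) h1 :
    (homCount Tm (SimpleGraph.pathGraph (k + 2)) : ℤ) ≤ homCount Tm Tn)
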